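/- Let $K$ be a field of characteristic zero. For $f,g\in K[[x]]$, where $g$ has zero constant term, let $f\circ g$ denote composition; let $\mathrm{id}(x)=x$, let $D$ be the formal derivative, and put $f_n=D^n(f)(0)$. A series $f$ with $f_0=0$ is called invertible if there is $\overline f\in K[[x]]$ with zero constant term and $f\circ\overline f=\overline f\circ f=\mathrm{id}$; $\overline f$ is then unique. Let $B_{n,k}$ be the partial (exponential) Bell polynomials, given by $\frac1{k!}\bigl(\sum_{m\ge1}X_m\frac{t^m}{m!}\bigr)^k=\sum_{n\ge k}B_{n,k}\frac{t^n}{n!}$, let the Laurent polynomials $A_{n,k}\in K[X_1,X_1^{-1},X_2,X_3,\ldots]$, $1\le k\le n$, be determined by $\sum_{j=k}^nA_{n,j}B_{j,k}=\delta_{n,k}$ for $1\le k\le n$, and let $$L_{n,k}=\sum_{j=k}^n(-1)^jA_{n,j}B_{j,k}\qquad(1\le k\le n)$$ be the multivariable Lah polynomials. **Theorem.** For every $n\ge1$, only the indeterminates $X_1,\ldots,X_{2\lfloor n/2\rfloor}$ (with $X_1$ possibly inverted) occur in $L_{n,1}$; in particular $L_{1,1}$ is a constant. Let $f,g\in K[[x]]$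 be invertible with $f\ne\mathrm{id}$, and let $f_n=D^n(f)(0)$, $g_n=D^n(g)(0)$. Then $f=g\circ(-\mathrm{id})\circ\overline g$ holds if and only if $$f_n=L_{n,1}(g_1,g_2,\ldots,g_{2\lfloor n/2\rfloor})\qquad\text{for all }n\ge1.$$ -/

import Mathlib

open scoped Nat

namespace LahRep

section Series

variable {K : Type*} [Field K]

/-- Composition `f ∘ g` of formal power series (used only when `g` has zero constant term). -/
noncomputable def comp (f g : PowerSeries K) : PowerSeries K := PowerSeries.subst g f

/-- `h` is a compositional inverse of `f`. The vanishing of both constant terms says that both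
compositions make sense as formal power series. -/
structure IsCompInverse (f h : PowerSeries K) : Prop where
  const_left : PowerSeries.constantCoeff f = 0
  const_right : PowerSeries.constantCoeff h = 0
  comp_right : comp f h = PowerSeries.X
  comp_left : comp h f = PowerSeries.X

/-- `f` is compositionally invertible. -/
def IsInvertible (f : PowerSeries K) : Prop := ∃ h, IsCompInverse f h

theorem IsCompInverse.unique {f h h' : PowerSeries K} (a : IsCompInverse f h)
    (b : IsCompInverse f h') : h = h' := by
  have hf := PowerSeries.HasSubst.of_constantCoeff_zero' a.const_left
  have hh' := PowerSeries.HasSubst.of_constantCoeff_zero' b.const_right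
  have key := PowerSeries.subst_comp_subst_apply hf hh' h
  have e1 : PowerSeries.subst f h = PowerSeries.X := a.comp_left
  have e2 : PowerSeries.subst h' f = PowerSeries.X := b.comp_right
  rw [e1, e2, PowerSeries.subst_X hh', PowerSeries.X_subst] at key
  exact key.symm

/-- The compositional inverse of an invertible `f` (and `0` if `f` is not invertible). -/
noncomputable def compInv (f : PowerSeries K) : PowerSeries K :=
  open scoped Classical in if h : IsInvertible f then h.choose else 0

theorem IsInvertible.isCompInverse {f : PowerSeries K} (hf : IsInvertible f) :
    IsCompInverse f (compInv f) := by
  unfold compInv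
  rw [dif_pos hf]
  exact hf.choose_spec

/-- The `n`-th Taylor coefficient `f_n = D^n(f)(0)`. -/
noncomputable def taylorCoeff (f : PowerSeries K) (n : ℕ) : K :=
  PowerSeries.constantCoeff ((PowerSeries.derivative K)^[n] f)

theorem IsInvertible.taylorCoeff_one_ne_zero {f : PowerSeries K} (hf : IsInvertible f) :
    taylorCoeff f 1 ≠ 0 := by
  have a := hf.isCompInverse
  obtain ⟨q, hq⟩ := PowerSeries.X_dvd_iff.mpr a.const_left
  intro h0
  have h1 : PowerSeries.coeff 1 f = 0 := by
    simpa [taylorCoeff, ← PowerSeries.coeff_zero_eq_constantCoeff_apply,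
      PowerSeries.coeff_derivative] using h0
  have hh := PowerSeries.HasSubst.of_constantCoeff_zero' a.const_right
  obtain ⟨p, hp⟩ := PowerSeries.X_dvd_iff.mpr a.const_right
  have hq0 : PowerSeries.constantCoeff q = 0 := by
    rw [hq, show (1 : ℕ) = 0 + 1 from rfl, mul_comm, PowerSeries.coeff_succ_mul_X] at h1
    simpa using h1
  obtain ⟨r, hr⟩ := PowerSeries.X_dvd_iff.mpr hq0
  have e : PowerSeries.subst (compInv f) f = PowerSeries.X := a.comp_right
  have e' : compInv f * (compInv f * PowerSeries.subst (compInv f) r) = PowerSeries.X := by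
    have hfr : f = PowerSeries.X * (PowerSeries.X * r) := by rw [← hr, ← hq]
    generalize compInv f = h at *
    rw [← e, hfr, PowerSeries.subst_mul hh, PowerSeries.subst_mul hh, PowerSeries.subst_X hh]
  have e2 := congrArg (PowerSeries.coeff 1) e'
  rw [hp, mul_assoc, show (1 : ℕ) = 0 + 1 from rfl, mul_comm, PowerSeries.coeff_succ_mul_X] at e2
  simp at e2

end Series

section Polynomials

variable (K : Type*) [Field K]

/-- The generic series `∑_{m ≥ 1} X_m t^m / m!` in `t`. The indeterminates are indexed by `ℕ` for
convenience; `X_0` is never used. -/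
noncomputable def genericSeries : PowerSeries (MvPolynomial ℕ K) :=
  PowerSeries.mk fun m =>
    if m = 0 then 0 else MvPolynomial.C ((m ! : K)⁻¹) * MvPolynomial.X m

/-- The partial (exponential) Bell polynomials `B_{n,k}`, given by
`(1/k!) (∑_{m ≥ 1} X_m t^m / m!)^k = ∑_n B_{n,k} t^n / n!`. -/
noncomputable def bellPoly (n k : ℕ) : MvPolynomial ℕ K :=
  MvPolynomial.C ((n ! : K) / (k ! : K)) * PowerSeries.coeff n (genericSeries K ^ k)

/-- The ring `K[X_1, X_1⁻¹, X_2, X_3, …]`. -/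
abbrev Laurent : Type _ := Localization.Away (MvPolynomial.X 1 : MvPolynomial ℕ K)

/-- The indeterminate `X_j` as a Laurent polynomial. -/
noncomputable def var (j : ℕ) : Laurent K :=
  algebraMap (MvPolynomial ℕ K) (Laurent K) (MvPolynomial.X j)

/-- `X_1⁻¹`. -/
noncomputable def invVar : Laurent K :=
  IsLocalization.Away.invSelf (MvPolynomial.X 1 : MvPolynomial ℕ K)

/-- `B_{n,k}` as a Laurent polynomial. -/
noncomputable def stirlingB (n k : ℕ) : Laurent K :=
  algebraMap (MvPolynomial ℕ K) (Laurent K) (bellPoly K n k)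

/-- The ortho-inverse companions `A_{n,k}` of the Bell polynomials: the unique solution of
`∑_{j=k}^n A_{n,j} B_{j,k} = δ_{n,k}`, solved for `A_{n,k}` by means of `B_{k,k} = X_1^k`
(see `sum_stirlingA_mul_stirlingB`). -/
noncomputable def stirlingA (n k : ℕ) : Laurent K :=
  ((if n = k then 1 else 0) -
    ∑ j : {j // j ∈ Finset.Ioc k n}, stirlingA n j.1 * stirlingB K j.1 k) * invVar K ^ k
termination_by n - k
decreasing_by
  have := Finset.mem_Ioc.mp j.2
  omega

theorem stirlingB_self [CharZero K] (k : ℕ) : stirlingB K k k = var K 1 ^ k := by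
  have h0 : PowerSeries.constantCoeff (genericSeries K) = 0 := by
    simp [genericSeries, ← PowerSeries.coeff_zero_eq_constantCoeff_apply]
  obtain ⟨q, hq⟩ := PowerSeries.X_dvd_iff.mpr h0
  have h1 : PowerSeries.constantCoeff q = MvPolynomial.X 1 := by
    have h : PowerSeries.coeff 1 (genericSeries K) = MvPolynomial.X 1 := by simp [genericSeries]
    rw [hq, show (1 : ℕ) = 0 + 1 from rfl, mul_comm, PowerSeries.coeff_succ_mul_X] at h
    simpa using h
  have hk : (k ! : K) ≠ 0 := by exact_mod_cast Nat.factorial_ne_zero k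
  have h2 : PowerSeries.coeff k (genericSeries K ^ k) = MvPolynomial.X 1 ^ k := by
    rw [hq, mul_pow]
    have := PowerSeries.coeff_X_pow_mul (q ^ k) k 0
    rw [zero_add] at this
    rw [this, PowerSeries.coeff_zero_eq_constantCoeff_apply, map_pow, h1]
  simp [stirlingB, bellPoly, var, h2, div_self hk]

theorem sum_stirlingA_mul_stirlingB [CharZero K] {n k : ℕ} (hkn : k ≤ n) :
    ∑ j ∈ Finset.Icc k n, stirlingA K n j * stirlingB K j k = if n = k then 1 else 0 := by
  have hinv : invVar K ^ k * var K 1 ^ k = 1 := by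
    rw [← mul_pow, mul_comm, var, invVar, IsLocalization.Away.mul_invSelf, one_pow]
  rw [← Finset.Ioc_insert_left hkn, Finset.sum_insert (by simp), stirlingB_self,
    stirlingA, mul_assoc, hinv, mul_one,
    Finset.sum_coe_sort (Finset.Ioc k n) fun j => stirlingA K n j * stirlingB K j k]
  ring

/-- The multivariable Lah polynomials `L_{n,k} = ∑_{j=k}^n (-1)^j A_{n,j} B_{j,k}`. -/
noncomputable def lah (n k : ℕ) : Laurent K :=
  ∑ j ∈ Finset.Icc k n, (-1) ^ j * stirlingA K n j * stirlingB K j k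

/-- The Laurent polynomials in the indeterminates `X_1, …, X_m` only, i.e. the subalgebra
generated by `X_1, X_1⁻¹, X_2, …, X_m` (the constants if `m = 0`). -/
noncomputable def laurentIn (m : ℕ) : Subalgebra K (Laurent K) :=
  Algebra.adjoin K ({p | ∃ j, 1 ≤ j ∧ j ≤ m ∧ p = var K j} ∪ {p | 1 ≤ m ∧ p = invVar K})

variable {K}

/-- Evaluation of Laurent polynomials at `X_j = c_j`, where `c_1 ≠ 0`. -/
noncomputable def evalLaurent (c : ℕ → K) (hc : c 1 ≠ 0) : Laurent K →+* K :=
  IsLocalization.Away.lift (g := MvPolynomial.eval c) (MvPolynomial.X 1 : MvPolynomial ℕ K)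
    (by simpa using hc)

end Polynomials

end LahRep

namespace LahRep

section Series

variable {K : Type*} [Field K]

/-! Setting `X_m = g_m` turns `B_{n,k}` into `n!/k! [x^n] g^k`. These matrices represent
composition, so `A_{n,k}` becomes the same expression for the inverse series `h` of `g`
(`evalLaurent_stirlingA`). As `(-h)^j = (-1)^j h^j`, the value of `L_{n,1}` is the `n`-th Taylor
coefficient of `g ∘ (-h)` (`taylorCoeff_comp_neg`), and the equivalence is a comparison of
coefficients. For the indeterminates with `n ≥ 2`, adding `∑ A_{n,j} B_{j,1} = 0` to `L_{n,1}`
leaves only even `j`. There `A_{n,j}` uses indices up to `n-j+1 ≤ n-1` and `B_{j,1}` up to `j`, all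
at most `2⌊n/2⌋`. -/

theorem coeff_pow_eq_zero {R : Type*} [CommRing R] {f : PowerSeries R}
    (hf : PowerSeries.constantCoeff f = 0) {n k : ℕ} (h : n < k) :
    PowerSeries.coeff n (f ^ k) = 0 := by
  have hd : PowerSeries.X ^ k ∣ f ^ k := pow_dvd_pow_of_dvd (PowerSeries.X_dvd_iff.mpr hf) k
  exact PowerSeries.X_pow_dvd_iff.mp hd n h

theorem coeff_comp {f g : PowerSeries K} (hg : PowerSeries.constantCoeff g = 0) (n : ℕ) :
    PowerSeries.coeff n (comp f g) =
      ∑ j ∈ Finset.range (n + 1), PowerSeries.coeff j f * PowerSeries.coeff n (g ^ j) := by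
  rw [comp, PowerSeries.coeff_subst' (PowerSeries.HasSubst.of_constantCoeff_zero' hg)]
  simp only [smul_eq_mul]
  refine finsum_eq_sum_of_support_subset _ fun j hj => ?_
  by_contra hn
  refine hj ?_
  simp only [Finset.coe_range, Set.mem_Iio, not_lt] at hn
  simp only [coeff_pow_eq_zero hg (show n < j by omega), mul_zero]

theorem taylorCoeff_eq (f : PowerSeries K) (n : ℕ) :
    taylorCoeff f n = (n ! : K) * PowerSeries.coeff n f := by
  induction n generalizing f with
  | zero => simp [taylorCoeff]
  | succ n ih =>
    have h : taylorCoeff f (n + 1) = taylorCoeff (PowerSeries.derivative K f) n := by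
      simp [taylorCoeff]
    rw [h, ih, PowerSeries.coeff_derivative, Nat.factorial_succ]
    push_cast
    ring

theorem comp_pow {f g : PowerSeries K} (hg : PowerSeries.constantCoeff g = 0) (k : ℕ) :
    comp f g ^ k = comp (f ^ k) g :=
  (PowerSeries.subst_pow (PowerSeries.HasSubst.of_constantCoeff_zero' hg) f k).symm

theorem coeff_comp_eq_sum_Icc {f g : PowerSeries K} (hf : PowerSeries.constantCoeff f = 0)
    (hg : PowerSeries.constantCoeff g = 0) (n k : ℕ) :
    PowerSeries.coeff n (comp (f ^ k) g) =
      ∑ j ∈ Finset.Icc k n, PowerSeries.coeff j (f ^ k) * PowerSeries.coeff n (g ^ j) := by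
  rw [coeff_comp hg]
  refine (Finset.sum_subset (fun j hj => ?_) fun j _ hj' => ?_).symm
  · rw [Finset.mem_Icc] at hj
    exact Finset.mem_range.mpr (by omega)
  · rw [coeff_pow_eq_zero hf, zero_mul]
    simp_all only [Finset.mem_range, Finset.mem_Icc]
    omega

theorem constantCoeff_comp {f g : PowerSeries K} (hf : PowerSeries.constantCoeff f = 0)
    (hg : PowerSeries.constantCoeff g = 0) : PowerSeries.constantCoeff (comp f g) = 0 := by
  rw [← PowerSeries.coeff_zero_eq_constantCoeff_apply, coeff_comp hg]
  simp [hf]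

theorem comp_neg_X {h : PowerSeries K} (hh : PowerSeries.constantCoeff h = 0) :
    comp (-PowerSeries.X) h = -h := by
  have hs := PowerSeries.HasSubst.of_constantCoeff_zero' hh
  rw [comp, ← PowerSeries.coe_substAlgHom hs, map_neg, PowerSeries.coe_substAlgHom hs,
    PowerSeries.subst_X hs]

theorem evalLaurent_algebraMap (c : ℕ → K) (hc : c 1 ≠ 0) (p : MvPolynomial ℕ K) :
    evalLaurent c hc (algebraMap _ (Laurent K) p) = MvPolynomial.eval c p :=
  IsLocalization.Away.lift_eq _ _ _

end Series

/-! ### Evaluation at the Taylor coefficients of a series -/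

section Evaluation

variable {K : Type*} [Field K] [CharZero K]

theorem map_eval_genericSeries {g : PowerSeries K} (hg : PowerSeries.constantCoeff g = 0) :
    PowerSeries.map (MvPolynomial.eval (taylorCoeff g)) (genericSeries K) = g := by
  ext n
  rcases eq_or_ne n 0 with rfl | hn
  · simp [genericSeries, hg]
  · have hn' : (n ! : K) ≠ 0 := by exact_mod_cast Nat.factorial_ne_zero n
    simp [genericSeries, hn, taylorCoeff_eq, hn']

theorem evalLaurent_stirlingB {g : PowerSeries K} (hg : PowerSeries.constantCoeff g = 0)
    (hc : taylorCoeff g 1 ≠ 0) (n k : ℕ) :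
    evalLaurent (taylorCoeff g) hc (stirlingB K n k) =
      (n ! : K) / (k ! : K) * PowerSeries.coeff n (g ^ k) := by
  rw [stirlingB, evalLaurent_algebraMap, bellPoly, map_mul, MvPolynomial.eval_C]
  conv_rhs => rw [← map_eval_genericSeries hg, ← map_pow, PowerSeries.coeff_map]

/-- The matrices of `f` and of its compositional inverse are inverse to each other. -/
theorem sum_coeff_pow_mul_coeff_pow {g h : PowerSeries K} (a : IsCompInverse g h) (n k : ℕ) :
    ∑ j ∈ Finset.Icc k n, ((n ! : K) / (j ! : K) * PowerSeries.coeff n (h ^ j)) *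
      ((j ! : K) / (k ! : K) * PowerSeries.coeff j (g ^ k)) = if n = k then 1 else 0 := by
  have key := coeff_comp_eq_sum_Icc a.const_left a.const_right n k
  -- Compare coefficients of `x^n` in `g^k ∘ h = (g ∘ h)^k = x^k`.
  rw [← comp_pow a.const_right, a.comp_right, PowerSeries.coeff_X_pow] at key
  have hk : (k ! : K) ≠ 0 := by exact_mod_cast Nat.factorial_ne_zero k
  calc _ = (n ! : K) / (k ! : K) * ∑ j ∈ Finset.Icc k n,
        PowerSeries.coeff j (g ^ k) * PowerSeries.coeff n (h ^ j) := by
        rw [Finset.mul_sum]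
        refine Finset.sum_congr rfl fun j _ => ?_
        have hj : (j ! : K) ≠ 0 := by exact_mod_cast Nat.factorial_ne_zero j
        field_simp
    _ = _ := by
        rw [← key]
        split_ifs with hnk
        · rw [hnk, mul_one, div_self hk]
        · rw [mul_zero]

/-- Both sides solve the same triangular system, whose diagonal entries `g_1^k` are nonzero; hence
induction on `n - k`. -/
theorem evalLaurent_stirlingA {g h : PowerSeries K} (a : IsCompInverse g h)
    (hc : taylorCoeff g 1 ≠ 0) {n k : ℕ} (hkn : k ≤ n) :
    evalLaurent (taylorCoeff g) hc (stirlingA K n k) =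
      (n ! : K) / (k ! : K) * PowerSeries.coeff n (h ^ k) := by
  induction hd : n - k using Nat.strong_induction_on generalizing k with
  | _ d ih =>
    have e1 := congrArg (evalLaurent (taylorCoeff g) hc) (sum_stirlingA_mul_stirlingB K hkn)
    have e2 := sum_coeff_pow_mul_coeff_pow a n k
    rw [map_sum, apply_ite (evalLaurent (taylorCoeff g) hc), map_one, map_zero, ← e2] at e1
    simp only [map_mul, ← evalLaurent_stirlingB a.const_left hc] at e1
    rw [← Finset.Ioc_insert_left hkn, Finset.sum_insert (by simp), Finset.sum_insert (by simp),
      Finset.sum_congr rfl fun j hj => ?_] at e1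
    -- The summand of the rewritten sum is still undetermined; it is supplied first.
    rotate_left
    · exact fun j => (n ! : K) / (j ! : K) * PowerSeries.coeff n (h ^ j) *
        evalLaurent (taylorCoeff g) hc (stirlingB K j k)
    · rw [Finset.mem_Ioc] at hj
      rw [ih (n - j) (by omega) hj.2 rfl]
    · refine mul_right_cancel₀ ?_ (add_right_cancel e1)
      rw [stirlingB_self, map_pow, var, evalLaurent_algebraMap, MvPolynomial.eval_X]
      exact pow_ne_zero k hc

theorem taylorCoeff_comp_neg {g h : PowerSeries K} (a : IsCompInverse g h)
    (hc : taylorCoeff g 1 ≠ 0) (n : ℕ) :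
    taylorCoeff (comp g (comp (-PowerSeries.X) h)) n =
      evalLaurent (taylorCoeff g) hc (lah K n 1) := by
  rw [comp_neg_X a.const_right, taylorCoeff_eq, lah, map_sum]
  have e := coeff_comp_eq_sum_Icc a.const_left
    (show PowerSeries.constantCoeff (-h) = 0 by simp [a.const_right]) n 1
  rw [pow_one] at e
  rw [e, Finset.mul_sum]
  refine Finset.sum_congr rfl fun j hj => ?_
  have hj0 : (j ! : K) ≠ 0 := by exact_mod_cast Nat.factorial_ne_zero j
  have hneg : PowerSeries.coeff n ((-h) ^ j) = (-1) ^ j * PowerSeries.coeff n (h ^ j) := by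
    rw [neg_pow]
    rcases Nat.even_or_odd j with e | e <;> simp [e.neg_one_pow]
  rw [hneg, map_mul, map_mul, map_pow (evalLaurent (taylorCoeff g) hc), map_neg, map_one,
    evalLaurent_stirlingA a hc (Finset.mem_Icc.mp hj).2, evalLaurent_stirlingB a.const_left,
    pow_one]
  simp only [Nat.factorial_one, Nat.cast_one, div_one]
  field_simp

end Evaluation

/-! ### Which indeterminates occur -/

section Indeterminates

variable (K : Type*) [Field K]

theorem var_mem_laurentIn {j m : ℕ} (h1 : 1 ≤ j) (hj : j ≤ m) : var K j ∈ laurentIn K m :=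
  Algebra.subset_adjoin (Or.inl ⟨j, h1, hj, rfl⟩)

theorem invVar_mem_laurentIn {m : ℕ} (hm : 1 ≤ m) : invVar K ∈ laurentIn K m :=
  Algebra.subset_adjoin (Or.inr ⟨hm, rfl⟩)

theorem algebraMap_C_mem_laurentIn (m : ℕ) (a : K) :
    algebraMap (MvPolynomial ℕ K) (Laurent K) (MvPolynomial.C a) ∈ laurentIn K m := by
  have h := (laurentIn K m).algebraMap_mem a
  rwa [IsScalarTower.algebraMap_apply K (MvPolynomial ℕ K) (Laurent K),
    MvPolynomial.algebraMap_eq] at h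

theorem constantCoeff_genericSeries : PowerSeries.constantCoeff (genericSeries K) = 0 := by
  simp [genericSeries, ← PowerSeries.coeff_zero_eq_constantCoeff_apply]

/-- In a product of `k ≥ 1` factors of order at least 1, the other `k - 1` use up degree `k - 1`, so
no index exceeds `n - k + 1`. -/
theorem coeff_genericSeries_pow_mem {n k m : ℕ} (h : n + 1 ≤ m + k) :
    algebraMap (MvPolynomial ℕ K) (Laurent K) (PowerSeries.coeff n (genericSeries K ^ k)) ∈
      laurentIn K m := by
  induction k generalizing n with
  | zero =>
    rw [pow_zero, PowerSeries.coeff_one]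
    split_ifs
    · rw [map_one]; exact one_mem _
    · rw [map_zero]; exact zero_mem _
  | succ k ih =>
    rw [pow_succ, PowerSeries.coeff_mul, map_sum]
    refine sum_mem fun p hp => ?_
    rw [Finset.HasAntidiagonal.mem_antidiagonal] at hp
    rw [map_mul]
    rcases Nat.eq_zero_or_pos p.2 with h2 | h2
    · rw [h2, PowerSeries.coeff_zero_eq_constantCoeff_apply, constantCoeff_genericSeries,
        map_zero, mul_zero]
      exact zero_mem _
    rcases lt_or_ge p.1 k with h1 | h1
    · rw [coeff_pow_eq_zero (constantCoeff_genericSeries K) h1, map_zero, zero_mul]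
      exact zero_mem _
    refine mul_mem (ih (by omega)) ?_
    rw [genericSeries, PowerSeries.coeff_mk, if_neg h2.ne', map_mul]
    exact mul_mem (algebraMap_C_mem_laurentIn K m _) (var_mem_laurentIn K h2 (by omega))

theorem stirlingB_mem_laurentIn {n k m : ℕ} (h : n + 1 ≤ m + k) :
    stirlingB K n k ∈ laurentIn K m := by
  rw [stirlingB, bellPoly, map_mul]
  exact mul_mem (algebraMap_C_mem_laurentIn K m _) (coeff_genericSeries_pow_mem K h)

theorem stirlingA_mem_laurentIn {n k m : ℕ} (hm : 1 ≤ m) (h : n + 1 ≤ m + k) :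
    stirlingA K n k ∈ laurentIn K m := by
  induction hd : n - k using Nat.strong_induction_on generalizing k with
  | _ d ih =>
    rw [stirlingA]
    refine mul_mem (sub_mem ?_ (sum_mem fun j _ => ?_)) (pow_mem (invVar_mem_laurentIn K hm) k)
    · split_ifs
      · exact one_mem _
      · exact zero_mem _
    · have hj := Finset.mem_Ioc.mp j.2
      exact mul_mem (ih (n - j) (by omega) (by omega) rfl) (stirlingB_mem_laurentIn K (by omega))

variable [CharZero K]

theorem lah_one_eq_sum {n : ℕ} (hn : 2 ≤ n) :
    lah K n 1 = ∑ j ∈ Finset.Ioc 1 n, ((-1) ^ j + 1) * (stirlingA K n j * stirlingB K j 1) := by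
  have h := sum_stirlingA_mul_stirlingB K (show 1 ≤ n by omega)
  rw [if_neg (by omega)] at h
  -- The added zero is the orthogonality relation; its `j = 1` term cancels that of `L_{n,1}`.
  rw [← add_zero (lah K n 1), ← h, lah, ← Finset.sum_add_distrib,
    ← Finset.Ioc_insert_left (show 1 ≤ n by omega), Finset.sum_insert (by simp)]
  rw [pow_one, neg_one_mul, neg_mul, neg_add_cancel, zero_add]
  exact Finset.sum_congr rfl fun j _ => by ring

theorem lah_one_mem_laurentIn {n : ℕ} (hn : 1 ≤ n) :
    lah K n 1 ∈ laurentIn K (2 * (n / 2)) := by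
  rcases hn.eq_or_lt with rfl | hn
  -- Here no indeterminate is allowed: `L_{1,1} = -A_{1,1} B_{1,1} = -1`.
  · have h := sum_stirlingA_mul_stirlingB K (le_refl 1)
    rw [Finset.Icc_self, Finset.sum_singleton, if_pos rfl] at h
    rw [lah, Finset.Icc_self, Finset.sum_singleton, mul_assoc, h, pow_one, mul_one]
    exact neg_mem (one_mem _)
  rw [lah_one_eq_sum K hn]
  refine sum_mem fun j hj => ?_
  rw [Finset.mem_Ioc] at hj
  rcases Nat.even_or_odd j with he | ho
  · obtain ⟨i, rfl⟩ := he
    exact mul_mem (add_mem (pow_mem (neg_mem (one_mem _)) _) (one_mem _))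
      (mul_mem (stirlingA_mem_laurentIn K (by omega) (by omega))
        (stirlingB_mem_laurentIn K (by omega)))
  · rw [ho.neg_one_pow, neg_add_cancel, zero_mul]
    exact zero_mem _

end Indeterminates

end LahRep

theorem mainTheorem3 {K : Type*} [Field K] [CharZero K] :
    (∀ n : ℕ, 1 ≤ n → LahRep.lah K n 1 ∈ LahRep.laurentIn K (2 * (n / 2))) ∧
    ∀ (f g : PowerSeries K) (_hf : LahRep.IsInvertible f) (hg : LahRep.IsInvertible g),
      f ≠ PowerSeries.X →
      (f = LahRep.comp g (LahRep.comp (-PowerSeries.X) (LahRep.compInv g)) ↔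
        ∀ n : ℕ, 1 ≤ n → LahRep.taylorCoeff f n =
          LahRep.evalLaurent (LahRep.taylorCoeff g) hg.taylorCoeff_one_ne_zero
            (LahRep.lah K n 1)) := by
  refine ⟨fun n hn => LahRep.lah_one_mem_laurentIn K hn, fun f g hf hg _ => ?_⟩
  have a := hg.isCompInverse
  have ht := LahRep.taylorCoeff_comp_neg a hg.taylorCoeff_one_ne_zero
  refine ⟨fun h n _ => by rw [← ht n, ← h], fun h => ?_⟩
  ext n
  rcases Nat.eq_zero_or_pos n with rfl | hn
  -- The hypothesis starts at `n = 1`; both constant terms vanish by invertibility.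
  · rw [PowerSeries.coeff_zero_eq_constantCoeff_apply,
      PowerSeries.coeff_zero_eq_constantCoeff_apply, hf.isCompInverse.const_left,
      LahRep.constantCoeff_comp a.const_left]
    rw [LahRep.comp_neg_X a.const_right, map_neg, a.const_right, neg_zero]
  · have e := h n hn
    rw [← ht n, LahRep.taylorCoeff_eq, LahRep.taylorCoeff_eq] at e
    exact mul_left_cancel₀ (by exact_mod_cast Nat.factorial_ne_zero n) e
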